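/- All logarithms and information measures are to base $2$. Let $\mathcal U,\mathcal X,\mathcal Y,\mathcal V,\mathcal Z$ be finite alphabets of sizes $J,K,L,M,s$, let $\ell\ge 1$, and let $n\ge 1$ be a multiple of $\ell$. A deterministic sequence $\mathbf u=(u_1,u_2,\ldots)$ over $\mathcal U$ is mapped by an arbitrary deterministic encoder to $\mathbf x=(x_1,x_2,\ldots)$ over $\mathcal X$, which is sent over a discrete memoryless channel $P(y|x)$ of capacity $C$ with output $Y_1,Y_2,\ldots$ in $\mathcal Y$. A decoder with state set $\mathcal Z$, a modulo-$\ell$ counter and delay $d\ge 0$ starts from a fixed state $z_1$ and computes, with $\tau=t \bmod \ell$, $$V_{t-d}=f_\tau(z_t,Y_t)\quad (t>d),\qquad z_{t+1}=g_\tau(z_t,Y_t)\quad (t\ge 1);$$ the last $d$ symbols of $V_1,\ldots,V_n$ (all $n$ of them if $d\ge n$), not yet produced at time $n$, are arbitrary (possibly random) elements of $\mathcal V$. Probabilities and expectations refer to the randomness of the channel. Let $\rho:\mathcal U\times\mathcal V\to[0,\infty)$ be a distortion measure and $\rho_{\max}=\max_{u,v}\rho(u,v)$. Let $U^\ell$ be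 distributed according to the empirical distribution of the $n/\ell$ non-overlapping blocks $u_{i\ell+1}^{i\ell+\ell}$, $0\le i<n/\ell$, let $\hat H$ and $\hat{\mathbf E}$ be entropy and expectation under this distribution, and for $R\ge 0$ put $$\tilde D_{U^\ell}(R)=\min_{q}\Big\{\tfrac1\ell\hat{\mathbf E}\rho(U^\ell,q(U^\ell)):\ \hat H(q(U^\ell))\le \ell R\Big\},$$ where $q$ ranges over the maps $\mathcal U^\ell\to\mathcal V^\ell$ and $\rho$ is extended additively to blocks. Let $\Delta(\varepsilon)=h_2(\varepsilon)+\varepsilon\ell\log J$, with $h_2$ the binary entropy function, and $$\delta_1(\ell,n)=\frac{(JK)^\ell\log L}{\sqrt n}+\frac{(JKL)^\ell\log e}{2n}+r(n),$$ $$\delta_2(\ell,n)=\delta_1(\ell,n)+\frac{2\ell(1+\log J)^2}{(1-\eta_n)\log n}+\frac{2\ell J^{2\ell}\log J}{n}+\frac1\ell,$$ where $\eta_n>0$ is any sequence tending to zero, with $\eta_n<1$ at the $n$ considered (for $n=1$ the term with $\log n$ in the denominator is read as $0$). Theorem. Given $\mathcal U,\mathcal X,\mathcal Y$ and $\ell$,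 there is a function $r(n)\ge 0$ with $r(n)=o(1/\sqrt n)$ as $n\to\infty$ such that the following holds for all the remaining objects above. If $q:\mathcal U^\ell\to\mathcal V^\ell$ and $\varepsilon_n\in[0,1]$ satisfy the common-reconstruction constraint $$\frac{\ell}{n}\sum_{i=0}^{n/\ell-1}\Pr\{V_{i\ell+1}^{i\ell+\ell}\ne q(u_{i\ell+1}^{i\ell+\ell})\}\le\varepsilon_n,$$ then $$\frac1n\sum_{t=1}^n\mathbf E\,\rho(u_t,V_t)\ \ge\ \tilde D_{U^\ell}\Big(C+\frac{2\log s+d\log M}{\ell}+\delta_2(\ell,n)+2\Delta(\varepsilon_n)\Big)-\rho_{\max}\,\varepsilon_n .$$ -/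

import Mathlib

open Filter MeasureTheory

/-- A discrete memoryless channel with finite output alphabet: the matrix of single-letter
transition probabilities `P(y|x)`. -/
structure DMC (𝒳 𝒴 : Type*) [Fintype 𝒴] where
  prob : 𝒳 → 𝒴 → ℝ
  nonneg : ∀ x y, 0 ≤ prob x y
  sum_eq_one : ∀ x, ∑ y, prob x y = 1

/-- Shannon entropy, in bits, of a probability mass function on a finite type. -/
noncomputable def entropyBits {α : Type*} [Fintype α] (p : α → ℝ) : ℝ :=
  ∑ a, Real.negMulLog (p a) / Real.log 2

/-- Binary entropy function `h₂`, in bits. -/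
noncomputable def h2 (p : ℝ) : ℝ := Real.binEntropy p / Real.log 2

/-- The mutual information `I(X;Y) = H(Y) - H(Y|X)`, in bits, between the input of a channel, with
probability mass function `p`, and its output. -/
noncomputable def DMC.mutualInfo {𝒳 𝒴 : Type*} [Fintype 𝒳] [Fintype 𝒴] (W : DMC 𝒳 𝒴)
    (p : 𝒳 → ℝ) : ℝ :=
  entropyBits (fun y => ∑ x, p x * W.prob x y) - ∑ x, p x * entropyBits (W.prob x)

/-- The channel capacity, in bits per channel use. -/
noncomputable def DMC.capacity {𝒳 𝒴 : Type*} [Fintype 𝒳] [Fintype 𝒴] (W : DMC 𝒳 𝒴) : ℝ :=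
  sSup (W.mutualInfo '' stdSimplex ℝ 𝒳)

/-- The random sequence `Y` is the response of the memoryless channel `W` to the deterministic
input sequence `x`. -/
structure DMC.IsOutput {Ω 𝒳 𝒴 : Type*} [MeasurableSpace Ω] [Fintype 𝒴] (W : DMC 𝒳 𝒴)
    (μ : Measure Ω) (x : ℕ → 𝒳) (Y : ℕ → Ω → 𝒴) : Prop where
  measurable : ∀ t y, MeasurableSet {ω | Y t ω = y}
  law : ∀ (m : ℕ) (y : ℕ → 𝒴),
    μ.real {ω | ∀ t < m, Y t ω = y t} = ∏ t ∈ Finset.range m, W.prob (x t) (y t)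

/-- A finite-state decoder equipped with a modulo-`ℓ` counter: initial state, next-state functions
`g_τ` and output functions `f_τ`, with `τ` the value of the counter. -/
structure FSDecoder (𝒴 𝒱 𝒵 : Type*) (ℓ : ℕ) where
  init : 𝒵
  next : Fin ℓ → 𝒵 → 𝒴 → 𝒵
  out : Fin ℓ → 𝒵 → 𝒴 → 𝒱

/-- The decoder state at time `t = 0, 1, 2, …` when the channel output is `y`;
`Fin.ofNat ℓ t` is `t mod ℓ`. -/
def FSDecoder.state {𝒴 𝒱 𝒵 : Type*} {ℓ : ℕ} [NeZero ℓ] (dec : FSDecoder 𝒴 𝒱 𝒵 ℓ)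
    (y : ℕ → 𝒴) : ℕ → 𝒵
  | 0 => dec.init
  | t + 1 => dec.next (Fin.ofNat ℓ t) (dec.state y t) (y t)

/-- `V` is a reconstruction of length `n`, with delay `d`, that the decoder produces from `Y`: the
symbol `V_t` is emitted at time `t + d`. The last `d` symbols (times `n - d ≤ t < n`), not yet
emitted when the transmission ends, are arbitrary, possibly random. -/
structure FSDecoder.IsReconstruction {Ω 𝒴 𝒱 𝒵 : Type*} [MeasurableSpace Ω] {ℓ : ℕ} [NeZero ℓ]
    (dec : FSDecoder 𝒴 𝒱 𝒵 ℓ) (d n : ℕ) (Y : ℕ → Ω → 𝒴) (V : ℕ → Ω → 𝒱) : Prop where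
  measurable : ∀ t < n, ∀ v, MeasurableSet {ω | V t ω = v}
  eq_out : ∀ t, t + d < n → ∀ ω,
    V t ω = dec.out (Fin.ofNat ℓ (t + d)) (dec.state (fun k => Y k ω) (t + d)) (Y (t + d) ω)

/-- The `i`-th (`i = 0, 1, …`) non-overlapping block of length `ℓ` of a sequence. -/
def block {α : Type*} (ℓ : ℕ) (a : ℕ → α) (i : ℕ) : Fin ℓ → α := fun j => a (i * ℓ + j)

open Classical in
/-- The empirical distribution of the random vector `U^ℓ`: the relative frequencies of the
`n / ℓ` non-overlapping `ℓ`-blocks of `u^n`. -/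
noncomputable def empDist {𝒰 : Type*} (ℓ n : ℕ) (u : ℕ → 𝒰) (b : Fin ℓ → 𝒰) : ℝ :=
  (ℓ : ℝ) / n * ((Finset.range (n / ℓ)).filter (fun i => block ℓ u i = b)).card

open Classical in
/-- The distribution of `q(A)` when `A` has distribution `p`. -/
noncomputable def mapDist {α β : Type*} [Fintype α] (q : α → β) (p : α → ℝ) (b : β) : ℝ :=
  ∑ a, if q a = b then p a else 0

/-- The empirical distortion per symbol `(1/ℓ) Ê ρ(U^ℓ, q(U^ℓ))` of a deterministic block map. -/
noncomputable def empDistortion {𝒰 𝒱 : Type*} [Fintype 𝒰] (ρ : 𝒰 → 𝒱 → ℝ) (ℓ n : ℕ) (u : ℕ → 𝒰)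
    (q : (Fin ℓ → 𝒰) → (Fin ℓ → 𝒱)) : ℝ :=
  1 / (ℓ : ℝ) * ∑ b, empDist ℓ n u b * ∑ j, ρ (b j) (q b j)

/-- The deterministic distortion-rate function `D̃_{U^ℓ}(R)`: the least empirical distortion of
block maps `q` with empirical output entropy at most `ℓ R`. The minimum is over a finite set, which
is non-empty for `R ≥ 0` because it contains the constant maps. -/
noncomputable def Dtilde {𝒰 𝒱 : Type*} [Fintype 𝒰] [Fintype 𝒱] (ρ : 𝒰 → 𝒱 → ℝ) (ℓ n : ℕ)
    (u : ℕ → 𝒰) (R : ℝ) : ℝ :=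
  sInf (empDistortion ρ ℓ n u ''
    {q : (Fin ℓ → 𝒰) → (Fin ℓ → 𝒱) | entropyBits (mapDist q (empDist ℓ n u)) ≤ ℓ * R})

/-- The redundancy term `δ₁(ℓ, n)` for alphabet sizes `J, K, L`; `r` is the `o(1/√n)` term. -/
noncomputable def delta1 (J K L ℓ n : ℕ) (r : ℕ → ℝ) : ℝ :=
  ((J : ℝ) * K) ^ ℓ * Real.logb 2 L / √(n : ℝ)
    + ((J : ℝ) * K * L) ^ ℓ * Real.logb 2 (Real.exp 1) / (2 * n) + r n

/-- The redundancy term `δ₂(ℓ, n)`; `η` is its positive sequence tending to zero. -/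
noncomputable def delta2 (J K L ℓ n : ℕ) (r η : ℕ → ℝ) : ℝ :=
  delta1 J K L ℓ n r
    + 2 * ℓ * (1 + Real.logb 2 J) ^ 2 / ((1 - η n) * Real.logb 2 n)
    + 2 * ℓ * (J : ℝ) ^ (2 * ℓ) * Real.logb 2 J / n + 1 / ℓ

/-- `Δ(ε) = h₂(ε) + ε ℓ log J`. -/
noncomputable def bigDelta (J ℓ : ℕ) (ε : ℝ) : ℝ := h2 ε + ε * ℓ * Real.logb 2 J

/-- The largest value of the distortion measure. -/
noncomputable def rhoMax {𝒰 𝒱 : Type*} (ρ : 𝒰 → 𝒱 → ℝ) : ℝ := ⨆ p : 𝒰 × 𝒱, ρ p.1 p.2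

/-!
Let `I` be uniform on the `n / ℓ` blocks. Block by block, a genie shows the decoder state at the
start of the block and the `d` reconstruction symbols that are emitted only after its end. The
reconstruction of the block is then a function of its channel outputs and of side information with
at most `s M^d` values. By common reconstruction it agrees with `q(U^ℓ)`, `U^ℓ` being block `I` of
`u`, except with probability `ε`, so Fano's inequality gives
`Ĥ(q(U^ℓ)) ≤ ℓ C + log s + d log M + Δ(ε)`. Hence `q` is admissible in the definition of the
distortion-rate function, and replacing `V` by `q(U^ℓ)` changes the distortion by at most `ρ_max ε`.

The converse is run with the law of the outputs averaged over `I`, and not with empirical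
frequencies of the outputs. No concentration argument is needed, and `r = 0` works.
-/

section MapDist

variable {α β γ : Type*} [Fintype α]

theorem mapDist_nonneg {f : α → β} {p : α → ℝ} (hp : ∀ a, 0 ≤ p a) (b : β) :
    0 ≤ mapDist f p b :=
  Finset.sum_nonneg fun a _ => by split_ifs <;> simp [hp a]

theorem sum_mapDist_mul [Fintype β] (f : α → β) (p : α → ℝ) (F : β → ℝ) :
    ∑ b, mapDist f p b * F b = ∑ a, p a * F (f a) := by
  classical
  simp only [mapDist, Finset.sum_mul]
  rw [Finset.sum_comm]
  exact Finset.sum_congr rfl fun a _ => by simp [ite_mul]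

theorem sum_mapDist [Fintype β] (f : α → β) (p : α → ℝ) : ∑ b, mapDist f p b = ∑ a, p a := by
  simpa using sum_mapDist_mul f p fun _ => 1

theorem mapDist_comp [Fintype β] (g : β → γ) (f : α → β) (p : α → ℝ) :
    mapDist (g ∘ f) p = mapDist g (mapDist f p) := by
  classical
  funext c
  have h := sum_mapDist_mul f p fun b => if g b = c then (1 : ℝ) else 0
  simp only [mul_ite, mul_one, mul_zero] at h
  simpa [mapDist] using h.symm

theorem le_mapDist {f : α → β} {p : α → ℝ} (hp : ∀ a, 0 ≤ p a) (a : α) :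
    p a ≤ mapDist f p (f a) := by
  classical
  have h := Finset.single_le_sum (f := fun a' => if f a' = f a then p a' else 0)
    (fun a' _ => by split_ifs <;> simp [hp a']) (Finset.mem_univ a)
  simpa [mapDist] using h

theorem mapDist_pos {f : α → β} {p : α → ℝ} (hp : ∀ a, 0 ≤ p a) {a : α} (ha : p a ≠ 0) :
    0 < mapDist f p (f a) :=
  ((hp a).lt_of_ne' ha).trans_le (le_mapDist hp a)

theorem mapDist_eq_zero {f : α → β} {p : α → ℝ} {b : β} (hb : ∀ a, f a ≠ b) :
    mapDist f p b = 0 :=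
  Finset.sum_eq_zero fun a _ => if_neg (hb a)

end MapDist

theorem entropyBits_eq_neg_sum {α : Type*} [Fintype α] (p : α → ℝ) :
    entropyBits p = -∑ a, p a * Real.logb 2 (p a) := by
  rw [entropyBits, ← Finset.sum_neg_distrib]
  exact Finset.sum_congr rfl fun a _ => by rw [Real.negMulLog, Real.logb]; ring

theorem entropyBits_mapDist {α β : Type*} [Fintype α] [Fintype β] (f : α → β) (p : α → ℝ) :
    entropyBits (mapDist f p) = -∑ a, p a * Real.logb 2 (mapDist f p (f a)) := by
  rw [entropyBits_eq_neg_sum, sum_mapDist_mul f p fun b => Real.logb 2 (mapDist f p b)]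

/-- The relative entropy `D(p‖q)`, in bits, which measures how far the channel outputs are from a
reference law. It is meaningful only if `q` vanishes nowhere on the support of `p`, since
`Real.logb 2 0 = 0`. -/
noncomputable def relEntropyBits {α : Type*} [Fintype α] (p q : α → ℝ) : ℝ :=
  ∑ a, p a * (Real.logb 2 (p a) - Real.logb 2 (q a))

section RelEntropy

variable {α β τ : Type*} [Fintype α] [Fintype β] [Fintype τ]

theorem relEntropyBits_nonneg {p q : α → ℝ} (hp : ∀ a, 0 ≤ p a) (hq : ∀ a, 0 ≤ q a)
    (hpq : ∀ a, p a ≠ 0 → q a ≠ 0) (hle : ∑ a, q a ≤ ∑ a, p a) : 0 ≤ relEntropyBits p q := by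
  have hlog : 0 < Real.log 2 := Real.log_pos one_lt_two
  have hterm (a : α) :
      (p a - q a) / Real.log 2 ≤ p a * (Real.logb 2 (p a) - Real.logb 2 (q a)) := by
    rcases (hp a).eq_or_lt' with h0 | hpa
    · simpa [h0, neg_div] using div_nonneg (hq a) hlog.le
    have hqa : 0 < q a := (hq a).lt_of_ne' (hpq a hpa.ne')
    have hlog_le : Real.log (q a) - Real.log (p a) ≤ q a / p a - 1 := by
      rw [← Real.log_div hqa.ne' hpa.ne']
      exact Real.log_le_sub_one_of_pos (div_pos hqa hpa)
    rw [Real.logb, Real.logb, ← sub_div, mul_div_assoc']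
    gcongr
    calc p a - q a = p a * -(q a / p a - 1) := by field_simp; ring
      _ ≤ p a * (Real.log (p a) - Real.log (q a)) := by gcongr; linarith
  calc 0 ≤ (∑ a, p a - ∑ a, q a) / Real.log 2 := div_nonneg (sub_nonneg.2 hle) hlog.le
    _ = ∑ a, (p a - q a) / Real.log 2 := by rw [← Finset.sum_sub_distrib, Finset.sum_div]
    _ ≤ relEntropyBits p q := Finset.sum_le_sum fun a _ => hterm a

theorem relEntropyBits_prod_uniform_le {p : β × τ → ℝ} (hp : ∀ o, 0 ≤ p o) (hp1 : ∑ o, p o = 1)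
    {q : β → ℝ} (hpq : ∀ o, p o ≠ 0 → q o.1 ≠ 0) :
    relEntropyBits p (fun o => q o.1 / Fintype.card τ)
      ≤ relEntropyBits (mapDist Prod.fst p) q + Real.logb 2 (Fintype.card τ) := by
  have hterm (o : β × τ) :
      p o * (Real.logb 2 (p o) - Real.logb 2 (q o.1 / Fintype.card τ))
        ≤ p o * (Real.logb 2 (mapDist Prod.fst p o.1) - Real.logb 2 (q o.1))
          + p o * Real.logb 2 (Fintype.card τ) := by
    rcases (hp o).eq_or_lt' with h0 | hpo
    · simp [h0]
    have hτ : (Fintype.card τ : ℝ) ≠ 0 := by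
      have : Nonempty τ := ⟨o.2⟩
      exact_mod_cast Fintype.card_ne_zero
    rw [Real.logb_div (hpq o hpo.ne') hτ, ← mul_add]
    have := Real.logb_le_logb_of_le one_lt_two hpo (le_mapDist (f := Prod.fst) hp o)
    gcongr
    linarith
  refine (Finset.sum_le_sum fun o _ => hterm o).trans_eq ?_
  rw [Finset.sum_add_distrib, ← Finset.sum_mul, hp1, one_mul, relEntropyBits,
    sum_mapDist_mul Prod.fst p fun b => Real.logb 2 (mapDist Prod.fst p b) - Real.logb 2 (q b)]

theorem sum_prod_eq_one {κ : Type*} [Fintype κ] [DecidableEq κ] {w : κ → β → ℝ}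
    (hw : ∀ j, ∑ b, w j b = 1) : ∑ y : κ → β, ∏ j, w j (y j) = 1 := by
  rw [← Fintype.prod_sum w]
  exact Finset.prod_eq_one fun j _ => hw j

theorem sum_prod_mul_apply {κ : Type*} [Fintype κ] [DecidableEq κ] {w : κ → β → ℝ}
    (hw : ∀ j, ∑ b, w j b = 1) (j : κ) (g : β → ℝ) :
    ∑ y : κ → β, (∏ k, w k (y k)) * g (y j) = ∑ b, w j b * g b := by
  calc ∑ y : κ → β, (∏ k, w k (y k)) * g (y j)
      = ∑ y : κ → β, ∏ k, w k (y k) * if k = j then g (y k) else 1 := by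
        simp only [Finset.prod_mul_distrib, Finset.prod_ite_eq', Finset.mem_univ, if_true]
    _ = ∏ k, ∑ b, w k b * if k = j then g b else 1 :=
        (Fintype.prod_sum fun k b => w k b * if k = j then g b else 1).symm
    _ = ∑ b, w j b * g b := by
        rw [Finset.prod_eq_single j (fun k _ hk => by simp [hk, hw]) (by simp)]
        simp

theorem relEntropyBits_pi {κ : Type*} [Fintype κ] [DecidableEq κ] {w : κ → β → ℝ}
    (hw : ∀ j, ∑ b, w j b = 1) {q : β → ℝ} (hwq : ∀ j b, w j b ≠ 0 → q b ≠ 0) :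
    relEntropyBits (fun y : κ → β => ∏ j, w j (y j)) (fun y => ∏ j, q (y j))
      = ∑ j, relEntropyBits (w j) q := by
  have hterm (y : κ → β) :
      (∏ j, w j (y j)) * (Real.logb 2 (∏ j, w j (y j)) - Real.logb 2 (∏ j, q (y j)))
        = ∑ j, (∏ k, w k (y k)) * (Real.logb 2 (w j (y j)) - Real.logb 2 (q (y j))) := by
    by_cases h : ∏ j, w j (y j) = 0
    · simp [h]
    have hne (j : κ) : w j (y j) ≠ 0 := Finset.prod_ne_zero_iff.1 h j (Finset.mem_univ j)
    rw [Real.logb_prod _ _ fun j _ => hne j, Real.logb_prod _ _ fun j _ => hwq j _ (hne j),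
      ← Finset.sum_sub_distrib, Finset.mul_sum]
  simp only [relEntropyBits, hterm]
  rw [Finset.sum_comm]
  exact Finset.sum_congr rfl fun j _ =>
    sum_prod_mul_apply hw j fun b => Real.logb 2 (w j b) - Real.logb 2 (q b)

end RelEntropy

section Converse

variable {ι γ σ : Type*} [Fintype ι] [Fintype σ] {π : ι → ℝ} {a : ι → γ}
  {P : ι → σ → ℝ}

-- The reference weights spread `R o * G c o` over the indices `i` with `a i = c` in proportion
-- to `π i`.
theorem sum_div_mapDist_mul_le_one [Finite γ] {R : σ → ℝ} (hR : ∀ o, 0 ≤ R o)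
    (hR1 : ∑ o, R o ≤ 1) {s : Finset γ} (has : ∀ i, a i ∈ s) {G : γ → σ → ℝ}
    (hG : ∀ c o, 0 ≤ G c o) (hG1 : ∀ o, ∑ c ∈ s, G c o ≤ 1) :
    ∑ x : ι × σ, π x.1 / mapDist a π (a x.1) * (R x.2 * G (a x.1) x.2) ≤ 1 := by
  cases nonempty_fintype γ
  have hguess (o : σ) : ∑ i, π i / mapDist a π (a i) * G (a i) o ≤ 1 := by
    calc ∑ i, π i / mapDist a π (a i) * G (a i) o
        = ∑ c, mapDist a π c * ((mapDist a π c)⁻¹ * G c o) := by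
          rw [sum_mapDist_mul a π fun c => (mapDist a π c)⁻¹ * G c o]
          simp only [div_eq_mul_inv, mul_assoc]
      _ = ∑ c ∈ s, mapDist a π c * ((mapDist a π c)⁻¹ * G c o) :=
          (Finset.sum_subset s.subset_univ fun c _ hc => by
            rw [mapDist_eq_zero fun i (hi : a i = c) => hc (hi ▸ has i), zero_mul]).symm
      _ ≤ ∑ c ∈ s, G c o := Finset.sum_le_sum fun c _ => by
          rw [← mul_assoc]
          exact mul_le_of_le_one_left (hG c o) mul_inv_le_one
      _ ≤ 1 := hG1 o
  calc ∑ x : ι × σ, π x.1 / mapDist a π (a x.1) * (R x.2 * G (a x.1) x.2)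
      = ∑ o, R o * ∑ i, π i / mapDist a π (a i) * G (a i) o := by
        rw [Fintype.sum_prod_type, Finset.sum_comm]
        simp only [Finset.mul_sum, mul_left_comm]
    _ ≤ ∑ o, R o := Finset.sum_le_sum fun o _ => mul_le_of_le_one_right (hR o) (hguess o)
    _ ≤ 1 := hR1

theorem entropyBits_mapDist_le_relEntropyBits_add_logLoss [Fintype γ] (hπ : ∀ i, 0 ≤ π i)
    (hπ1 : ∑ i, π i = 1) (hP : ∀ i o, 0 ≤ P i o) (hP1 : ∀ i, ∑ o, P i o = 1) {R : σ → ℝ}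
    (hR : ∀ o, 0 ≤ R o) (hR1 : ∑ o, R o ≤ 1) (hPR : ∀ i o, π i ≠ 0 → P i o ≠ 0 → R o ≠ 0)
    {s : Finset γ} (has : ∀ i, a i ∈ s) {G : γ → σ → ℝ} (hG : ∀ c o, 0 ≤ G c o)
    (hG1 : ∀ o, ∑ c ∈ s, G c o ≤ 1) (hPG : ∀ i o, π i ≠ 0 → P i o ≠ 0 → G (a i) o ≠ 0) :
    entropyBits (mapDist a π) ≤ ∑ i, π i * relEntropyBits (P i) R
      + ∑ i, π i * ∑ o, P i o * -Real.logb 2 (G (a i) o) := by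
  set p := mapDist a π with hp
  let T : ι × σ → ℝ := fun x => π x.1 * P x.1 x.2
  let Q : ι × σ → ℝ := fun x => π x.1 / p (a x.1) * (R x.2 * G (a x.1) x.2)
  have hp_ne (i : ι) (hi : π i ≠ 0) : p (a i) ≠ 0 := (mapDist_pos hπ hi).ne'
  have hT1 : ∑ x, T x = 1 := by
    simp only [T, Fintype.sum_prod_type, ← Finset.mul_sum, hP1, mul_one, hπ1]
  have hgibbs : 0 ≤ relEntropyBits T Q := by
    refine relEntropyBits_nonneg (fun x => mul_nonneg (hπ _) (hP _ _))
      (fun x => mul_nonneg (div_nonneg (hπ _) (mapDist_nonneg hπ _))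
        (mul_nonneg (hR _) (hG _ _))) (fun x hx => ?_)
      ((sum_div_mapDist_mul_le_one hR hR1 has hG hG1).trans hT1.ge)
    have hi := left_ne_zero_of_mul hx
    have ho := right_ne_zero_of_mul hx
    exact mul_ne_zero (div_ne_zero hi (hp_ne _ hi)) (mul_ne_zero (hPR _ _ hi ho) (hPG _ _ hi ho))
  have hterm (i : ι) (o : σ) : T (i, o) * (Real.logb 2 (T (i, o)) - Real.logb 2 (Q (i, o)))
      = π i * Real.logb 2 (p (a i)) * P i o
        + π i * (P i o * (Real.logb 2 (P i o) - Real.logb 2 (R o)))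
        + π i * (P i o * -Real.logb 2 (G (a i) o)) := by
    rcases eq_or_ne (π i) 0 with hi | hi
    · simp [T, hi]
    rcases eq_or_ne (P i o) 0 with ho | ho
    · simp [T, ho]
    have hRo := hPR i o hi ho
    have hGo := hPG i o hi ho
    simp only [T, Q]
    rw [Real.logb_mul hi ho, Real.logb_mul (div_ne_zero hi (hp_ne i hi)) (mul_ne_zero hRo hGo),
      Real.logb_div hi (hp_ne i hi), Real.logb_mul hRo hGo]
    ring
  have hsum : relEntropyBits T Q = ∑ i, π i * Real.logb 2 (p (a i))
      + ∑ i, π i * relEntropyBits (P i) R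
      + ∑ i, π i * ∑ o, P i o * -Real.logb 2 (G (a i) o) := by
    rw [relEntropyBits, Fintype.sum_prod_type]
    simp only [hterm, Finset.sum_add_distrib, ← Finset.mul_sum, hP1, mul_one, relEntropyBits]
  rw [hp, entropyBits_mapDist]
  linarith

/-- The Fano guess of a letter `c` from an estimate `v`: weight `1 - ε` on `c = v`, while the
weight `ε` is spread uniformly over `m` letters. -/
noncomputable def fanoGuess [DecidableEq γ] (ε : ℝ) (m : ℕ) (c v : γ) : ℝ :=
  (if v = c then 1 - ε else 0) + ε / m

theorem fanoGuess_nonneg [DecidableEq γ] {ε : ℝ} (hε0 : 0 ≤ ε) (hε1 : ε ≤ 1) (m : ℕ) (c v : γ) :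
    0 ≤ fanoGuess ε m c v :=
  add_nonneg (by split_ifs <;> linarith) (by positivity)

theorem sum_fanoGuess_le_one [DecidableEq γ] {ε : ℝ} (hε0 : 0 ≤ ε) (hε1 : ε ≤ 1) (s : Finset γ)
    (v : γ) : ∑ c ∈ s, fanoGuess ε s.card c v ≤ 1 := by
  simp only [fanoGuess, Finset.sum_add_distrib, Finset.sum_ite_eq, Finset.sum_const, nsmul_eq_mul]
  have hcard : (s.card : ℝ) * (ε / s.card) ≤ ε := by
    rw [mul_div_left_comm]
    exact mul_le_of_le_one_right hε0 (div_self_le_one _)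
  split_ifs <;> linarith

theorem logLoss_fanoGuess_le {ε e : ℝ} {m : ℕ} (hε0 : 0 ≤ ε) (hε1 : ε ≤ 1) (hm : m ≠ 0)
    (he0 : 0 ≤ e) (he : e ≤ ε) :
    (1 - e) * -Real.logb 2 (1 - ε + ε / m) + e * -Real.logb 2 (ε / m)
      ≤ h2 ε + ε * Real.logb 2 m := by
  have hh2 : h2 ε = (1 - ε) * -Real.logb 2 (1 - ε) + ε * -Real.logb 2 ε := by
    rw [h2, Real.binEntropy_eq_negMulLog_add_negMulLog_one_sub]
    simp only [Real.negMulLog, Real.logb]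
    ring
  rcases hε0.eq_or_lt with rfl | hε
  · simp [hh2, le_antisymm he he0]
  have hm0 : (0 : ℝ) < m := by positivity
  have hq : 0 < ε / m := div_pos hε hm0
  have hmono : Real.logb 2 (ε / m) ≤ Real.logb 2 (1 - ε + ε / m) :=
    Real.logb_le_logb_of_le one_lt_two hq (by linarith)
  have hmain : (1 - ε) * -Real.logb 2 (1 - ε + ε / m) ≤ (1 - ε) * -Real.logb 2 (1 - ε) := by
    rcases hε1.eq_or_lt with rfl | hlt
    · simp
    have := Real.logb_le_logb_of_le one_lt_two (sub_pos.2 hlt) (by linarith : 1 - ε ≤ 1 - ε + ε / m)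
    gcongr
  calc (1 - e) * -Real.logb 2 (1 - ε + ε / m) + e * -Real.logb 2 (ε / m)
      ≤ (1 - ε) * -Real.logb 2 (1 - ε + ε / m) + ε * -Real.logb 2 (ε / m) := by
        linarith [mul_nonneg (sub_nonneg.2 he) (sub_nonneg.2 hmono)]
    _ ≤ (1 - ε) * -Real.logb 2 (1 - ε) + ε * -Real.logb 2 (ε / m) := by gcongr
    _ = h2 ε + ε * Real.logb 2 m := by rw [Real.logb_div hε.ne' hm0.ne', hh2]; ring

variable [DecidableEq γ]

theorem sum_mul_neg_logb_fanoGuess (hπ1 : ∑ i, π i = 1) (hP1 : ∀ i, ∑ o, P i o = 1) (f : σ → γ)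
    (ε : ℝ) (m : ℕ) :
    ∑ i, π i * ∑ o, P i o * -Real.logb 2 (fanoGuess ε m (a i) (f o))
      = (1 - ∑ i, π i * ∑ o with f o ≠ a i, P i o) * -Real.logb 2 (1 - ε + ε / m)
        + (∑ i, π i * ∑ o with f o ≠ a i, P i o) * -Real.logb 2 (ε / m) := by
  have hterm (i : ι) (o : σ) : P i o * -Real.logb 2 (fanoGuess ε m (a i) (f o))
      = P i o * -Real.logb 2 (1 - ε + ε / m) + (if f o ≠ a i then P i o else 0)
        * (Real.logb 2 (1 - ε + ε / m) - Real.logb 2 (ε / m)) := by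
    by_cases h : f o = a i
    · simp [fanoGuess, h]
    · simp only [fanoGuess, ne_eq, h, not_false_eq_true, if_true, if_false, zero_add]
      ring
  simp only [hterm, Finset.sum_add_distrib, ← Finset.sum_mul, hP1, one_mul, mul_add, ← mul_assoc,
    hπ1, Finset.sum_filter]
  ring

theorem sum_mul_error_eq_zero (hπ : ∀ i, 0 ≤ π i) (hP : ∀ i o, 0 ≤ P i o) {f : σ → γ}
    (herr : ∑ i, π i * ∑ o with f o ≠ a i, P i o ≤ 0) {i : ι} {o : σ} (hi : π i ≠ 0)
    (ho : P i o ≠ 0) : f o = a i := by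
  have herr_nonneg (j : ι) : 0 ≤ ∑ o with f o ≠ a j, P j o := Finset.sum_nonneg fun o _ => hP j o
  have hsum := le_antisymm herr (Finset.sum_nonneg fun j _ => mul_nonneg (hπ j) (herr_nonneg j))
  have hzero : π i * ∑ o with f o ≠ a i, P i o = 0 :=
    (Finset.sum_eq_zero_iff_of_nonneg fun j _ => mul_nonneg (hπ j) (herr_nonneg j)).1 hsum i
      (Finset.mem_univ i)
  by_contra hne
  exact ho ((Finset.sum_eq_zero_iff_of_nonneg fun o _ => hP i o).1
    ((mul_eq_zero.1 hzero).resolve_left hi) o (by simpa using hne))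

-- Fano's converse: Gibbs' inequality with the guess `fanoGuess` of `a i` from the estimate `f o`.
theorem entropyBits_mapDist_le_relEntropyBits_add_h2 [Fintype γ] (hπ : ∀ i, 0 ≤ π i)
    (hπ1 : ∑ i, π i = 1) (hP : ∀ i o, 0 ≤ P i o) (hP1 : ∀ i, ∑ o, P i o = 1) {R : σ → ℝ}
    (hR : ∀ o, 0 ≤ R o) (hR1 : ∑ o, R o ≤ 1) (hPR : ∀ i o, π i ≠ 0 → P i o ≠ 0 → R o ≠ 0)
    {s : Finset γ} (has : ∀ i, a i ∈ s) {f : σ → γ} {ε : ℝ} (hε0 : 0 ≤ ε) (hε1 : ε ≤ 1)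
    (herr : ∑ i, π i * ∑ o with f o ≠ a i, P i o ≤ ε) :
    entropyBits (mapDist a π) ≤ ∑ i, π i * relEntropyBits (P i) R
      + (h2 ε + ε * Real.logb 2 s.card) := by
  obtain ⟨i₀, -, -⟩ := Finset.exists_ne_zero_of_sum_ne_zero (hπ1.trans_ne one_ne_zero)
  have hs : s.card ≠ 0 := Finset.card_ne_zero_of_mem (has i₀)
  have hguess (i : ι) (o : σ) (hi : π i ≠ 0) (ho : P i o ≠ 0) :
      fanoGuess ε s.card (a i) (f o) ≠ 0 := by
    rcases hε0.eq_or_lt with rfl | hε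
    · simp [fanoGuess, sum_mul_error_eq_zero hπ hP herr hi ho]
    · exact (add_pos_of_nonneg_of_pos (by split_ifs <;> linarith) (by positivity)).ne'
  refine (entropyBits_mapDist_le_relEntropyBits_add_logLoss hπ hπ1 hP hP1 hR hR1 hPR has
    (G := fun c o => fanoGuess ε s.card c (f o)) (fun c o => fanoGuess_nonneg hε0 hε1 _ c _)
    (fun o => sum_fanoGuess_le_one hε0 hε1 s (f o)) hguess).trans ?_
  rw [sum_mul_neg_logb_fanoGuess hπ1 hP1]
  exact add_le_add le_rfl (logLoss_fanoGuess_le hε0 hε1 hs (Finset.sum_nonneg fun i _ =>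
    mul_nonneg (hπ i) (Finset.sum_nonneg fun o _ => hP i o)) herr)

end Converse

namespace DMC

variable {𝒳 𝒴 κ : Type*} [Fintype 𝒳] [Fintype 𝒴] (W : DMC 𝒳 𝒴)

/-- The law of the output of the channel when its input has distribution `p`. It is the reference
law against which the relative entropy of the channel outputs is measured. -/
def outputDist (p : 𝒳 → ℝ) (y : 𝒴) : ℝ := ∑ x, p x * W.prob x y

theorem outputDist_nonneg {p : 𝒳 → ℝ} (hp : ∀ x, 0 ≤ p x) (y : 𝒴) : 0 ≤ W.outputDist p y :=
  Finset.sum_nonneg fun x _ => mul_nonneg (hp x) (W.nonneg x y)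

theorem sum_outputDist (p : 𝒳 → ℝ) : ∑ y, W.outputDist p y = ∑ x, p x := by
  simp only [outputDist]
  rw [Finset.sum_comm]
  simp only [← Finset.mul_sum, W.sum_eq_one, mul_one]

theorem outputDist_ne_zero {p : 𝒳 → ℝ} (hp : ∀ x, 0 ≤ p x) {x : 𝒳} (hx : p x ≠ 0) {y : 𝒴}
    (hy : W.prob x y ≠ 0) : W.outputDist p y ≠ 0 := fun h =>
  mul_ne_zero hx hy <| (Finset.sum_eq_zero_iff_of_nonneg fun x _ =>
    mul_nonneg (hp x) (W.nonneg x y)).1 h x (Finset.mem_univ x)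

theorem mutualInfo_eq_sum_relEntropyBits (p : 𝒳 → ℝ) :
    W.mutualInfo p = ∑ x, p x * relEntropyBits (W.prob x) (W.outputDist p) := by
  have hout : entropyBits (W.outputDist p)
      = -∑ x, p x * ∑ y, W.prob x y * Real.logb 2 (W.outputDist p y) := by
    rw [entropyBits_eq_neg_sum]
    conv_lhs => enter [1, 2, y, 1]; rw [outputDist]
    simp only [Finset.sum_mul, Finset.mul_sum, mul_assoc]
    rw [Finset.sum_comm]
  change entropyBits (W.outputDist p) - _ = _
  rw [hout]
  simp only [entropyBits_eq_neg_sum, relEntropyBits, mul_sub, Finset.sum_sub_distrib, mul_neg,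
    Finset.sum_neg_distrib]
  ring

theorem bddAbove_mutualInfo : BddAbove (W.mutualInfo '' stdSimplex ℝ 𝒳) := by
  refine (isCompact_stdSimplex ℝ 𝒳).bddAbove_image (Continuous.continuousOn ?_)
  unfold mutualInfo entropyBits
  fun_prop

theorem sum_mul_relEntropyBits_le_capacity {p : 𝒳 → ℝ} (hp : p ∈ stdSimplex ℝ 𝒳) :
    ∑ x, p x * relEntropyBits (W.prob x) (W.outputDist p) ≤ W.capacity := by
  rw [← mutualInfo_eq_sum_relEntropyBits]
  exact le_csSup W.bddAbove_mutualInfo ⟨p, hp, rfl⟩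

/-- The distribution of a uniformly chosen letter of the random block `x i`, where `i` has
distribution `π`. This is the input distribution whose mutual information bounds the information
that a block carries. -/
noncomputable def letterDist {ι : Type*} [Fintype ι] [Fintype κ] (π : ι → ℝ) (x : ι → κ → 𝒳) :
    𝒳 → ℝ :=
  mapDist (fun ik : ι × κ => x ik.1 ik.2) fun ik => π ik.1 / Fintype.card κ

section Block

variable {ι : Type*} [Fintype ι] [Fintype κ] {π : ι → ℝ}

theorem letterDist_mem_stdSimplex [Nonempty κ] (hπ : π ∈ stdSimplex ℝ ι) (x : ι → κ → 𝒳) :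
    letterDist π x ∈ stdSimplex ℝ 𝒳 := by
  have hκ : (Fintype.card κ : ℝ) ≠ 0 := by exact_mod_cast Fintype.card_ne_zero
  refine ⟨fun _ => mapDist_nonneg (fun ik => div_nonneg (hπ.1 _) (Nat.cast_nonneg _)) _, ?_⟩
  rw [letterDist, sum_mapDist, Fintype.sum_prod_type]
  simp [mul_div_cancel₀, hκ, hπ.2]

theorem outputDist_letterDist_ne_zero [Nonempty κ] (hπ : ∀ i, 0 ≤ π i) (x : ι → κ → 𝒳) {i : ι}
    (hi : π i ≠ 0) (k : κ) {y : 𝒴} (hy : W.prob (x i k) y ≠ 0) :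
    W.outputDist (letterDist π x) y ≠ 0 := by
  have hκ : (Fintype.card κ : ℝ) ≠ 0 := by exact_mod_cast Fintype.card_ne_zero
  have hw (ik : ι × κ) : 0 ≤ π ik.1 / Fintype.card κ := div_nonneg (hπ _) (Nat.cast_nonneg _)
  refine W.outputDist_ne_zero (mapDist_nonneg hw) (x := x i k) ?_ hy
  exact (mapDist_pos (f := fun ik : ι × κ => x ik.1 ik.2) hw (a := (i, k)) (div_ne_zero hi hκ)).ne'

/-- The reference law of a block of channel outputs: independent letters, each distributed like the
output at a uniformly chosen letter of the random block `x i`. -/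
noncomputable def blockOutputDist (π : ι → ℝ) (x : ι → κ → 𝒳) (y : κ → 𝒴) : ℝ :=
  ∏ k, W.outputDist (letterDist π x) (y k)

theorem blockOutputDist_nonneg [Nonempty κ] (hπ : π ∈ stdSimplex ℝ ι) (x : ι → κ → 𝒳)
    (y : κ → 𝒴) : 0 ≤ W.blockOutputDist π x y :=
  Finset.prod_nonneg fun _ _ => W.outputDist_nonneg (letterDist_mem_stdSimplex hπ x).1 _

theorem sum_blockOutputDist [DecidableEq κ] [Nonempty κ] (hπ : π ∈ stdSimplex ℝ ι)
    (x : ι → κ → 𝒳) : ∑ y, W.blockOutputDist π x y = 1 :=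
  sum_prod_eq_one fun _ => (W.sum_outputDist _).trans (letterDist_mem_stdSimplex hπ x).2

theorem blockOutputDist_ne_zero [Nonempty κ] (hπ : ∀ i, 0 ≤ π i) (x : ι → κ → 𝒳) {i : ι}
    (hi : π i ≠ 0) {y : κ → 𝒴} (hy : ∏ k, W.prob (x i k) (y k) ≠ 0) :
    W.blockOutputDist π x y ≠ 0 :=
  Finset.prod_ne_zero_iff.2 fun k hk =>
    W.outputDist_letterDist_ne_zero hπ x hi k (Finset.prod_ne_zero_iff.1 hy k hk)

theorem sum_mul_relEntropyBits_block_le [DecidableEq κ] [Nonempty κ] (hπ : π ∈ stdSimplex ℝ ι)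
    (x : ι → κ → 𝒳) :
    ∑ i, π i * relEntropyBits (fun y => ∏ k, W.prob (x i k) (y k)) (W.blockOutputDist π x)
      ≤ Fintype.card κ * W.capacity := by
  have hκ : (Fintype.card κ : ℝ) ≠ 0 := by exact_mod_cast Fintype.card_ne_zero
  let Q := W.outputDist (letterDist π x)
  have hblock (i : ι) :
      π i * relEntropyBits (fun y => ∏ k, W.prob (x i k) (y k)) (W.blockOutputDist π x)
        = Fintype.card κ * ∑ k, π i / Fintype.card κ * relEntropyBits (W.prob (x i k)) Q := by
    rcases eq_or_ne (π i) 0 with hi | hi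
    · simp [hi]
    unfold blockOutputDist
    rw [relEntropyBits_pi (w := fun k => W.prob (x i k)) (fun k => W.sum_eq_one _)
      (fun k y hy => W.outputDist_letterDist_ne_zero hπ.1 x hi k hy), ← Finset.mul_sum,
      ← mul_assoc, mul_div_cancel₀ _ hκ]
  calc _ = Fintype.card κ * ∑ x', letterDist π x x' * relEntropyBits (W.prob x') Q := by
        rw [letterDist, sum_mapDist_mul, Fintype.sum_prod_type, Finset.mul_sum]
        exact Finset.sum_congr rfl fun i _ => hblock i
    _ ≤ Fintype.card κ * W.capacity := by
        gcongr
        exact W.sum_mul_relEntropyBits_le_capacity (letterDist_mem_stdSimplex hπ x)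

end Block

end DMC

section SideInfo

variable {𝒳 𝒴 ι κ τ γ : Type*} [Fintype 𝒴] [Fintype κ] [DecidableEq κ] [Fintype τ] (W : DMC 𝒳 𝒴)

theorem sum_eq_one_of_mapDist_fst {x : κ → 𝒳} {P : (κ → 𝒴) × τ → ℝ}
    (hPW : mapDist Prod.fst P = fun y => ∏ k, W.prob (x k) (y k)) : ∑ o, P o = 1 := by
  rw [← sum_mapDist Prod.fst, hPW]
  exact sum_prod_eq_one (w := fun k => W.prob (x k)) fun _ => W.sum_eq_one _

variable [Fintype 𝒳] [Fintype ι] [Nonempty κ] {π : ι → ℝ} {x : ι → κ → 𝒳}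
  {P : ι → (κ → 𝒴) × τ → ℝ}

theorem blockOutputDist_fst_ne_zero (hπ : ∀ i, 0 ≤ π i) (hP : ∀ i o, 0 ≤ P i o)
    (hPW : ∀ i, mapDist Prod.fst (P i) = fun y => ∏ k, W.prob (x i k) (y k)) {i : ι}
    {o : (κ → 𝒴) × τ} (hi : π i ≠ 0) (ho : P i o ≠ 0) : W.blockOutputDist π x o.1 ≠ 0 := by
  have hW := (mapDist_pos (f := Prod.fst) (hP i) ho).ne'
  rw [hPW] at hW
  exact W.blockOutputDist_ne_zero hπ x hi hW

theorem sum_mul_relEntropyBits_sideInfo_le (hπ : π ∈ stdSimplex ℝ ι) (hP : ∀ i o, 0 ≤ P i o)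
    (hPW : ∀ i, mapDist Prod.fst (P i) = fun y => ∏ k, W.prob (x i k) (y k)) :
    ∑ i, π i * relEntropyBits (P i) (fun o => W.blockOutputDist π x o.1 / Fintype.card τ)
      ≤ Fintype.card κ * W.capacity + Real.logb 2 (Fintype.card τ) := by
  have hterm (i : ι) :
      π i * relEntropyBits (P i) (fun o => W.blockOutputDist π x o.1 / Fintype.card τ)
        ≤ π i * relEntropyBits (fun y => ∏ k, W.prob (x i k) (y k)) (W.blockOutputDist π x)
          + π i * Real.logb 2 (Fintype.card τ) := by
    rcases eq_or_ne (π i) 0 with hi | hi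
    · simp [hi]
    rw [← mul_add, ← hPW]
    exact mul_le_mul_of_nonneg_left (relEntropyBits_prod_uniform_le (hP i)
      (sum_eq_one_of_mapDist_fst W (hPW i))
      fun o => blockOutputDist_fst_ne_zero W hπ.1 hP hPW hi) (hπ.1 i)
  refine (Finset.sum_le_sum fun i _ => hterm i).trans ?_
  rw [Finset.sum_add_distrib, ← Finset.sum_mul, hπ.2, one_mul]
  gcongr
  exact W.sum_mul_relEntropyBits_block_le hπ x

-- A genie hands the side information `τ` to the decoder: it enters the reference law as a uniform
-- factor, which costs at most `log |τ|` bits.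
theorem entropyBits_mapDist_le_capacity_add_sideInfo [Fintype γ] [DecidableEq γ]
    (hπ : π ∈ stdSimplex ℝ ι) (hP : ∀ i o, 0 ≤ P i o)
    (hPW : ∀ i, mapDist Prod.fst (P i) = fun y => ∏ k, W.prob (x i k) (y k))
    {a : ι → γ} {s : Finset γ} (has : ∀ i, a i ∈ s) {f : (κ → 𝒴) × τ → γ} {ε : ℝ} (hε0 : 0 ≤ ε)
    (hε1 : ε ≤ 1) (herr : ∑ i, π i * ∑ o with f o ≠ a i, P i o ≤ ε) :
    entropyBits (mapDist a π) ≤ Fintype.card κ * W.capacity + Real.logb 2 (Fintype.card τ)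
      + (h2 ε + ε * Real.logb 2 s.card) := by
  have hcard (o : (κ → 𝒴) × τ) : (Fintype.card τ : ℝ) ≠ 0 := by
    have : Nonempty τ := ⟨o.2⟩
    exact_mod_cast Fintype.card_ne_zero
  have hR1 : ∑ o : (κ → 𝒴) × τ, W.blockOutputDist π x o.1 / Fintype.card τ ≤ 1 := by
    simp only [Fintype.sum_prod_type, Finset.sum_const, nsmul_eq_mul, ← Finset.mul_sum,
      ← Finset.sum_div, W.sum_blockOutputDist hπ, Finset.card_univ, mul_one]
    exact div_self_le_one _
  exact (entropyBits_mapDist_le_relEntropyBits_add_h2 hπ.1 hπ.2 hP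
    (fun i => sum_eq_one_of_mapDist_fst W (hPW i))
    (fun o => div_nonneg (W.blockOutputDist_nonneg hπ x _) (Nat.cast_nonneg _)) hR1
    (fun i o hi ho => div_ne_zero (blockOutputDist_fst_ne_zero W hπ.1 hP hPW hi ho) (hcard o))
    has hε0 hε1 herr).trans
    (add_le_add_left (sum_mul_relEntropyBits_sideInfo_le W hπ hP hPW) _)

end SideInfo

/-- The probability mass function, under `μ`, of a random variable `X`. It turns the channel outputs
and the decoder's side information into the finite distributions of the converse. -/
noncomputable def probMass {Ω α : Type*} [MeasurableSpace Ω] (μ : Measure Ω) (X : Ω → α) (a : α) :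
    ℝ :=
  μ.real {ω | X ω = a}

section ProbMass

variable {Ω α β : Type*} [MeasurableSpace Ω] {μ : Measure Ω} [IsFiniteMeasure μ] [Fintype α]
  [MeasurableSpace α] [MeasurableSingletonClass α] {X : Ω → α}

theorem sum_probMass_filter (hX : Measurable X) (p : α → Prop) [DecidablePred p] :
    ∑ a with p a, probMass μ X a = μ.real {ω | p (X ω)} := by
  have h := sum_measureReal_preimage_singleton (μ := μ) (f := X) (Finset.univ.filter p)
    fun a _ => hX (measurableSet_singleton a)
  rw [Finset.coe_filter_univ] at h
  exact h

theorem mapDist_probMass (hX : Measurable X) (f : α → β) :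
    mapDist f (probMass μ X) = probMass μ (f ∘ X) := by
  classical
  funext b
  have h : _ = probMass μ (f ∘ X) b := sum_probMass_filter (μ := μ) hX fun a => f a = b
  rw [Finset.sum_filter] at h
  simpa [mapDist] using h

end ProbMass

section ChannelOutput

variable {Ω 𝒳 𝒴 : Type*} [MeasurableSpace Ω] {μ : Measure Ω} [IsFiniteMeasure μ] [Fintype 𝒴]
  {W : DMC 𝒳 𝒴} {x : ℕ → 𝒳} {Y : ℕ → Ω → 𝒴}

theorem measureReal_shift_eq_sum (hY : ∀ t y, MeasurableSet {ω | Y t ω = y}) (m k : ℕ)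
    (y : ℕ → 𝒴) :
    μ.real {ω | ∀ t < k, Y (m + 1 + t) ω = y t}
      = ∑ b, μ.real {ω | ∀ t < k + 1, Y (m + t) ω = Nat.casesOn t b y} := by
  have h := sum_measureReal_preimage_singleton
    (μ := μ.restrict {ω | ∀ t < k, Y (m + 1 + t) ω = y t}) (f := Y m) Finset.univ
    fun b _ => hY m b
  simp only [Finset.coe_univ, Set.preimage_univ, measureReal_restrict_apply_univ] at h
  rw [← h]
  refine Finset.sum_congr rfl fun b _ => (measureReal_restrict_apply (hY m b)).trans ?_
  congr 1
  ext ω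
  simp only [Set.mem_inter_iff, Set.mem_ofPred_eq, Nat.forall_lt_succ_left, Nat.rec_zero, add_zero,
    add_assoc, add_comm 1]

theorem DMC.IsOutput.measureReal_shift (hY : W.IsOutput μ x Y) (m : ℕ) :
    ∀ (k : ℕ) (y : ℕ → 𝒴), μ.real {ω | ∀ t < k, Y (m + t) ω = y t}
      = ∏ t ∈ Finset.range k, W.prob (x (m + t)) (y t) := by
  induction m with
  | zero => simpa using hY.law
  | succ m ih =>
    intro k y
    rw [measureReal_shift_eq_sum hY.measurable]
    simp only [ih, Finset.prod_range_succ', ← Finset.mul_sum, Nat.rec_zero, add_zero,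
      W.sum_eq_one, mul_one]
    simp only [add_assoc, add_comm 1]

theorem DMC.IsOutput.probMass_block (hY : W.IsOutput μ x Y) (ℓ : ℕ) [NeZero ℓ] (i : ℕ) :
    probMass μ (fun ω => block ℓ (fun t => Y t ω) i)
      = fun y => ∏ j, W.prob (block ℓ x i j) (y j) := by
  funext y
  have hset : {ω | block ℓ (fun t => Y t ω) i = y}
      = {ω | ∀ t < ℓ, Y (i * ℓ + t) ω = y (Fin.ofNat ℓ t)} := by
    ext ω
    simp only [block, funext_iff, Fin.forall_iff, Set.mem_ofPred_eq]
    exact forall₂_congr fun t ht => by simp [Fin.ofNat, Nat.mod_eq_of_lt ht]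
  rw [probMass, hset, hY.measureReal_shift, Finset.prod_range]
  simp [block]

end ChannelOutput

namespace FSDecoder

variable {Ω 𝒴 𝒱 𝒵 : Type*} {ℓ : ℕ} [NeZero ℓ] (dec : FSDecoder 𝒴 𝒱 𝒵 ℓ)

theorem state_congr {y y' : ℕ → 𝒴} {t : ℕ} (h : ∀ k < t, y k = y' k) :
    dec.state y t = dec.state y' t := by
  induction t with
  | zero => rfl
  | succ t ih => rw [state, state, ih fun k hk => h k (hk.trans t.lt_succ_self), h t t.lt_succ_self]

theorem counter_mul_add (i t : ℕ) : Fin.ofNat ℓ (i * ℓ + t) = Fin.ofNat ℓ t := by simp [Fin.ofNat]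

theorem state_mul_add (y : ℕ → 𝒴) (i t : ℕ) :
    dec.state y (i * ℓ + t)
      = { dec with init := dec.state y (i * ℓ) }.state (fun k => y (i * ℓ + k)) t := by
  induction t with
  | zero => rfl
  | succ t ih => rw [← add_assoc, state, state, ih, counter_mul_add]

/-- What a genie shows of the `i`-th block: the channel outputs, the decoder state at the start, and
the last `d` reconstruction symbols, which are emitted only in later blocks. If `ℓ < d`, truncated
subtraction repeats the first symbol of the block. -/
def blockObs (d : ℕ) (Y : ℕ → Ω → 𝒴) (V : ℕ → Ω → 𝒱) (i : ℕ) (ω : Ω) :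
    (Fin ℓ → 𝒴) × 𝒵 × (Fin d → 𝒱) :=
  (block ℓ (fun t => Y t ω) i, dec.state (fun t => Y t ω) (i * ℓ),
    fun k => V (i * ℓ + (k + ℓ - d)) ω)

/-- The reconstruction of a block computed from the observation `blockObs`: the decoder is run from
the given state, and the symbols it would emit after the block are read off. -/
def blockOut (d : ℕ) (o : (Fin ℓ → 𝒴) × 𝒵 × (Fin d → 𝒱)) (j : Fin ℓ) : 𝒱 :=
  if h : j + d < ℓ then
    dec.out (Fin.ofNat ℓ (j + d))
      ({ dec with init := o.2.1 }.state (fun k => o.1 (Fin.ofNat ℓ k)) (j + d)) (o.1 ⟨j + d, h⟩)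
  else o.2.2 ⟨j + d - ℓ, by omega⟩

variable [MeasurableSpace Ω] {Y : ℕ → Ω → 𝒴} {V : ℕ → Ω → 𝒱}

theorem IsReconstruction.block_eq_blockOut {dec : FSDecoder 𝒴 𝒱 𝒵 ℓ} {d n : ℕ}
    (hV : dec.IsReconstruction d n Y V) {i : ℕ} (hi : i * ℓ + ℓ ≤ n) (ω : Ω) :
    block ℓ (fun t => V t ω) i = dec.blockOut d (dec.blockObs d Y V i ω) := by
  funext j
  by_cases h : j + d < ℓ
  · have hstate : dec.state (fun t => Y t ω) (i * ℓ + (j + d))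
        = { dec with init := dec.state (fun t => Y t ω) (i * ℓ) }.state
          (fun k => block ℓ (fun t => Y t ω) i (Fin.ofNat ℓ k)) (j + d) := by
      rw [state_mul_add]
      exact state_congr _ fun k hk => by simp [block, Fin.ofNat, Nat.mod_eq_of_lt (hk.trans h)]
    simp only [block, blockOut, blockObs, h, dif_pos]
    rw [hV.eq_out _ (by omega), add_assoc, hstate, counter_mul_add]
    rfl
  · simp only [block, blockOut, blockObs, h, dif_neg, not_false_eq_true]
    congr 2
    omega

variable [MeasurableSpace 𝒴] [MeasurableSingletonClass 𝒴] [Finite 𝒴] [MeasurableSpace 𝒵]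
  [MeasurableSingletonClass 𝒵] [Finite 𝒵]

theorem measurable_state (hY : ∀ t, Measurable (Y t)) (t : ℕ) :
    Measurable fun ω => dec.state (fun k => Y k ω) t := by
  induction t with
  | zero => exact measurable_const
  | succ t ih =>
    exact (Measurable.of_discrete (f := fun p : 𝒵 × 𝒴 => dec.next (Fin.ofNat ℓ t) p.1 p.2)).comp
      (ih.prodMk (hY t))

theorem measurable_blockObs [MeasurableSpace 𝒱] {d n : ℕ} (hY : ∀ t, Measurable (Y t))
    (hV : ∀ t < n, Measurable (V t)) {i : ℕ} (hi : i * ℓ + ℓ ≤ n) :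
    Measurable (dec.blockObs d Y V i) := by
  refine (measurable_pi_lambda _ fun j => hY _).prodMk
    ((dec.measurable_state hY _).prodMk (measurable_pi_lambda _ fun k => hV _ ?_))
  have := NeZero.pos ℓ
  omega

end FSDecoder

section Empirical

variable {ℓ n : ℕ}

theorem empDist_eq_mapDist {𝒰 : Type*} (ℓ n : ℕ) (u : ℕ → 𝒰) :
    empDist ℓ n u = mapDist (fun i : Fin (n / ℓ) => block ℓ u i) fun _ => (ℓ : ℝ) / n := by
  classical
  funext b
  calc empDist ℓ n u b
      = ∑ i ∈ Finset.range (n / ℓ), if block ℓ u i = b then (ℓ : ℝ) / n else 0 := by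
        rw [← Finset.sum_filter, Finset.sum_const, nsmul_eq_mul, mul_comm, empDist]
    _ = mapDist (fun i : Fin (n / ℓ) => block ℓ u i) (fun _ => (ℓ : ℝ) / n) b := by
        rw [← Fin.sum_univ_eq_sum_range]
        simp only [mapDist]

theorem sum_range_eq_sum_blocks {M : Type*} [AddCommMonoid M] (hdvd : ℓ ∣ n) (f : ℕ → M) :
    ∑ t ∈ Finset.range n, f t = ∑ i : Fin (n / ℓ), ∑ j : Fin ℓ, f (i * ℓ + j) := by
  conv_lhs => rw [← Nat.div_mul_cancel hdvd, ← Fin.sum_univ_eq_sum_range,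
    ← finProdFinEquiv.sum_comp, Fintype.sum_prod_type]
  simp [add_comm, mul_comm]

variable [NeZero ℓ]

theorem const_mem_stdSimplex_blocks (hn : 0 < n) (hdvd : ℓ ∣ n) :
    (fun _ => (ℓ : ℝ) / n) ∈ stdSimplex ℝ (Fin (n / ℓ)) := by
  refine ⟨fun _ => by positivity, ?_⟩
  have hℓ : (ℓ : ℝ) ≠ 0 := NeZero.ne _
  have hn0 : (n : ℝ) ≠ 0 := by positivity
  rw [Finset.sum_const, Finset.card_univ, Fintype.card_fin, nsmul_eq_mul, Nat.cast_div hdvd hℓ]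
  field_simp

theorem mul_add_le_of_lt_div {i : ℕ} (hi : i < n / ℓ) : i * ℓ + ℓ ≤ n := by
  rw [← Nat.succ_mul]
  exact (Nat.le_div_iff_mul_le (NeZero.pos ℓ)).1 hi

end Empirical

theorem logb_two_natCast_nonneg (m : ℕ) : 0 ≤ Real.logb 2 (m : ℝ) :=
  div_nonneg (Real.log_natCast_nonneg m) (Real.log_nonneg one_le_two)

theorem h2_nonneg {ε : ℝ} (hε0 : 0 ≤ ε) (hε1 : ε ≤ 1) : 0 ≤ h2 ε :=
  div_nonneg (Real.binEntropy_nonneg hε0 hε1) (Real.log_nonneg one_le_two)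

theorem logb_two_card_prod_pi {𝒵 𝒱 : Type*} [Fintype 𝒵] [Fintype 𝒱] [Nonempty 𝒵] [Nonempty 𝒱]
    (d : ℕ) : Real.logb 2 (Fintype.card (𝒵 × (Fin d → 𝒱)))
      = Real.logb 2 (Fintype.card 𝒵) + d * Real.logb 2 (Fintype.card 𝒱) := by
  rw [Fintype.card_prod, Fintype.card_fun, Fintype.card_fin, Nat.cast_mul, Nat.cast_pow,
    Real.logb_mul (by simp) (by simp), Real.logb_pow]

theorem h2_add_mul_logb_card_image_le_bigDelta {𝒰 β : Type*} [Fintype 𝒰] [DecidableEq β] {ℓ : ℕ}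
    (q : (Fin ℓ → 𝒰) → β) {ε : ℝ} (hε0 : 0 ≤ ε) :
    h2 ε + ε * Real.logb 2 (Finset.univ.image q).card ≤ bigDelta (Fintype.card 𝒰) ℓ ε := by
  have hcard : (Finset.univ.image q).card ≤ Fintype.card 𝒰 ^ ℓ := by
    simpa using Finset.card_image_le (s := Finset.univ) (f := q)
  rw [bigDelta, mul_assoc, ← Real.logb_pow, ← Nat.cast_pow]
  refine add_le_add le_rfl (mul_le_mul_of_nonneg_left ?_ hε0)
  rcases (Finset.univ.image q).card.eq_zero_or_pos with h0 | hpos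
  · simp only [h0, Nat.cast_zero, Real.logb_zero, logb_two_natCast_nonneg]
  · exact Real.logb_le_logb_of_le one_lt_two (Nat.cast_pos.2 hpos) (Nat.cast_le.2 hcard)

theorem le_rhoMax {𝒰 𝒱 : Type*} [Finite 𝒰] [Finite 𝒱] (ρ : 𝒰 → 𝒱 → ℝ) (a : 𝒰) (v : 𝒱) :
    ρ a v ≤ rhoMax ρ :=
  le_ciSup (f := fun p : 𝒰 × 𝒱 => ρ p.1 p.2) (Set.finite_range _).bddAbove (a, v)

theorem rhoMax_nonneg {𝒰 𝒱 : Type*} {ρ : 𝒰 → 𝒱 → ℝ} (hρ : ∀ a v, 0 ≤ ρ a v) : 0 ≤ rhoMax ρ :=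
  Real.iSup_nonneg fun _ => hρ _ _

theorem empDistortion_eq_sum_blocks {𝒰 𝒱 : Type*} [Fintype 𝒰] (ρ : 𝒰 → 𝒱 → ℝ)
    (ℓ n : ℕ) [NeZero ℓ] (u : ℕ → 𝒰) (q : (Fin ℓ → 𝒰) → (Fin ℓ → 𝒱)) :
    empDistortion ρ ℓ n u q
      = 1 / (n : ℝ) * ∑ i : Fin (n / ℓ), ∑ j : Fin ℓ, ρ (u (i * ℓ + j)) (q (block ℓ u i) j) := by
  have hℓ : (ℓ : ℝ) ≠ 0 := NeZero.ne _
  rw [empDistortion, empDist_eq_mapDist, sum_mapDist_mul, ← Finset.mul_sum, ← mul_assoc]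
  congr 1
  field_simp

theorem Dtilde_le_empDistortion {𝒰 𝒱 : Type*} [Fintype 𝒰] [Fintype 𝒱] {ρ : 𝒰 → 𝒱 → ℝ}
    {ℓ n : ℕ} {u : ℕ → 𝒰} {q : (Fin ℓ → 𝒰) → (Fin ℓ → 𝒱)} {R : ℝ}
    (hq : entropyBits (mapDist q (empDist ℓ n u)) ≤ ℓ * R) :
    Dtilde ρ ℓ n u R ≤ empDistortion ρ ℓ n u q :=
  csInf_le (Set.toFinite _).bddBelow ⟨q, hq, rfl⟩

theorem measurableSet_block_ne {𝒱 Ω : Type*} [MeasurableSpace Ω] {ℓ n : ℕ} {V : ℕ → Ω → 𝒱}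
    (hV : ∀ t < n, ∀ v, MeasurableSet {ω | V t ω = v}) {i : ℕ} (hi : i * ℓ + ℓ ≤ n)
    (b : Fin ℓ → 𝒱) : MeasurableSet {ω | block ℓ (fun t => V t ω) i ≠ b} := by
  have heq : {ω | block ℓ (fun t => V t ω) i ≠ b}
      = (⋂ j : Fin ℓ, {ω | V (i * ℓ + j) ω = b j})ᶜ := by
    ext ω
    simp [block, funext_iff]
  exact heq ▸ (MeasurableSet.iInter fun j => hV _ (by omega) _).compl

theorem apply_sub_mul_measureReal_le_integral {𝒱 Ω : Type*} [Finite 𝒱] [MeasurableSpace Ω]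
    {μ : Measure Ω} [IsProbabilityMeasure μ] {X : Ω → 𝒱}
    (hX : ∀ v, MeasurableSet {ω | X ω = v}) {F : 𝒱 → ℝ} (hF : ∀ v, 0 ≤ F v) {v : 𝒱} {c : ℝ}
    (hc : F v ≤ c) {E : Set Ω} (hE : MeasurableSet E) (hXE : ∀ ω ∉ E, X ω = v) :
    F v - c * μ.real E ≤ ∫ ω, F (X ω) ∂μ := by
  let _ : MeasurableSpace 𝒱 := ⊤
  have hint : Integrable (fun ω => F (X ω)) μ :=
    (Integrable.of_finite (μ := μ.map X)).comp_measurable (measurable_to_countable' hX)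
  calc F v - c * μ.real E ≤ F v - F v * μ.real E := by gcongr
    _ = ∫ _ in Eᶜ, F v ∂μ := by
        rw [setIntegral_const, probReal_compl_eq_one_sub hE, smul_eq_mul]
        ring
    _ = ∫ ω in Eᶜ, F (X ω) ∂μ :=
        setIntegral_congr_fun hE.compl fun ω hω => by simp only [hXE ω hω]
    _ ≤ ∫ ω, F (X ω) ∂μ := setIntegral_le_integral hint (ae_of_all _ fun ω => hF _)

section CommonReconstruction

variable {𝒰 𝒳 𝒴 𝒱 𝒵 Ω : Type*} [Fintype 𝒰] [MeasurableSpace Ω] {μ : Measure Ω}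
  [IsProbabilityMeasure μ] {ℓ d n : ℕ} [NeZero ℓ] {V : ℕ → Ω → 𝒱} {u : ℕ → 𝒰}
  {q : (Fin ℓ → 𝒰) → (Fin ℓ → 𝒱)} {ε : ℝ}

theorem entropyBits_mapDist_empDist_le [Fintype 𝒳] [Fintype 𝒴] [Fintype 𝒱] [Fintype 𝒵]
    {W : DMC 𝒳 𝒴} {x : ℕ → 𝒳} {Y : ℕ → Ω → 𝒴} (hY : W.IsOutput μ x Y)
    {dec : FSDecoder 𝒴 𝒱 𝒵 ℓ} (hn : 0 < n) (hdvd : ℓ ∣ n) (hV : dec.IsReconstruction d n Y V)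
    (hε0 : 0 ≤ ε) (hε1 : ε ≤ 1)
    (hCR : (ℓ : ℝ) / n * ∑ i ∈ Finset.range (n / ℓ),
      μ.real {ω | block ℓ (fun t => V t ω) i ≠ q (block ℓ u i)} ≤ ε) :
    entropyBits (mapDist q (empDist ℓ n u))
      ≤ ℓ * W.capacity + (Real.logb 2 (Fintype.card 𝒵) + d * Real.logb 2 (Fintype.card 𝒱))
        + bigDelta (Fintype.card 𝒰) ℓ ε := by
  classical
  let _ : MeasurableSpace 𝒴 := ⊤
  let _ : MeasurableSpace 𝒱 := ⊤
  let _ : MeasurableSpace 𝒵 := ⊤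
  obtain ⟨ω⟩ : Nonempty Ω := nonempty_of_isProbabilityMeasure μ
  have : Nonempty 𝒵 := ⟨dec.init⟩
  have : Nonempty 𝒱 := ⟨V 0 ω⟩
  have hobs (i : Fin (n / ℓ)) : Measurable (dec.blockObs d Y V i) :=
    dec.measurable_blockObs (fun t => measurable_to_countable' (hY.measurable t))
      (fun t ht => measurable_to_countable' (hV.measurable t ht)) (mul_add_le_of_lt_div i.2)
  have hPW (i : Fin (n / ℓ)) : mapDist Prod.fst (probMass μ (dec.blockObs d Y V i))
      = fun y => ∏ j, W.prob (block ℓ x i j) (y j) :=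
    (mapDist_probMass (hobs i) Prod.fst).trans (hY.probMass_block ℓ i)
  have herr : ∑ i : Fin (n / ℓ), (ℓ : ℝ) / n * ∑ o with dec.blockOut d o ≠ q (block ℓ u i),
      probMass μ (dec.blockObs d Y V i) o ≤ ε := by
    simp only [sum_probMass_filter (hobs _),
      ← hV.block_eq_blockOut (mul_add_le_of_lt_div (Fin.is_lt _))]
    rwa [← Finset.mul_sum, Fin.sum_univ_eq_sum_range
      fun i => μ.real {ω | block ℓ (fun t => V t ω) i ≠ q (block ℓ u i)}]
  have hconverse := entropyBits_mapDist_le_capacity_add_sideInfo W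
    (const_mem_stdSimplex_blocks hn hdvd) (fun i o => measureReal_nonneg) hPW
    (a := fun i => q (block ℓ u i)) (s := Finset.univ.image q)
    (fun i => Finset.mem_image_of_mem q (Finset.mem_univ _)) hε0 hε1 herr
  rw [Fintype.card_fin, logb_two_card_prod_pi] at hconverse
  rw [empDist_eq_mapDist, ← mapDist_comp]
  exact hconverse.trans (by gcongr; exact h2_add_mul_logb_card_image_le_bigDelta q hε0)

theorem empDistortion_sub_rhoMax_mul_le [Finite 𝒱] {ρ : 𝒰 → 𝒱 → ℝ} (hρ : ∀ a v, 0 ≤ ρ a v)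
    (hdvd : ℓ ∣ n) (hV : ∀ t < n, ∀ v, MeasurableSet {ω | V t ω = v})
    (hCR : (ℓ : ℝ) / n * ∑ i ∈ Finset.range (n / ℓ),
      μ.real {ω | block ℓ (fun t => V t ω) i ≠ q (block ℓ u i)} ≤ ε) :
    empDistortion ρ ℓ n u q - rhoMax ρ * ε
      ≤ 1 / (n : ℝ) * ∑ t ∈ Finset.range n, ∫ ω, ρ (u t) (V t ω) ∂μ := by
  let E (i : ℕ) : Set Ω := {ω | block ℓ (fun t => V t ω) i ≠ q (block ℓ u i)}
  have hsymbol (i : Fin (n / ℓ)) (j : Fin ℓ) :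
      ρ (u (i * ℓ + j)) (q (block ℓ u i) j) - rhoMax ρ * μ.real (E i)
        ≤ ∫ ω, ρ (u (i * ℓ + j)) (V (i * ℓ + j) ω) ∂μ := by
    have hi := mul_add_le_of_lt_div i.2
    exact apply_sub_mul_measureReal_le_integral (hV _ (by omega)) (hρ _) (le_rhoMax ρ _ _)
      (measurableSet_block_ne hV hi _) fun ω hω => congrFun (not_not.1 hω) j
  have herr : 1 / (n : ℝ) * ∑ i : Fin (n / ℓ), ∑ _j : Fin ℓ, rhoMax ρ * μ.real (E i)
      ≤ rhoMax ρ * ε := by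
    refine le_trans (le_of_eq ?_) (mul_le_mul_of_nonneg_left hCR (rhoMax_nonneg hρ))
    simp only [Finset.sum_const, Finset.card_univ, Fintype.card_fin, nsmul_eq_mul,
      ← Finset.mul_sum, Fin.sum_univ_eq_sum_range fun i => μ.real (E i)]
    ring
  calc empDistortion ρ ℓ n u q - rhoMax ρ * ε
      ≤ 1 / (n : ℝ) * ∑ i : Fin (n / ℓ), ∑ j : Fin ℓ,
          (ρ (u (i * ℓ + j)) (q (block ℓ u i) j) - rhoMax ρ * μ.real (E i)) := by
        simp only [Finset.sum_sub_distrib, mul_sub, ← empDistortion_eq_sum_blocks]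
        exact sub_le_sub_left herr _
    _ ≤ 1 / (n : ℝ) * ∑ t ∈ Finset.range n, ∫ ω, ρ (u t) (V t ω) ∂μ := by
        rw [sum_range_eq_sum_blocks hdvd]
        gcongr with i _ j _
        exact hsymbol i j

theorem theorem3_general [Fintype 𝒳] [Fintype 𝒴] [Fintype 𝒱] [Fintype 𝒵] {ρ : 𝒰 → 𝒱 → ℝ}
    (hρ : ∀ a v, 0 ≤ ρ a v) {W : DMC 𝒳 𝒴} {x : ℕ → 𝒳} {Y : ℕ → Ω → 𝒴} (hY : W.IsOutput μ x Y)
    {dec : FSDecoder 𝒴 𝒱 𝒵 ℓ} (hn : 0 < n) (hdvd : ℓ ∣ n) (hV : dec.IsReconstruction d n Y V)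
    (hε0 : 0 ≤ ε) (hε1 : ε ≤ 1)
    (hCR : (ℓ : ℝ) / n * ∑ i ∈ Finset.range (n / ℓ),
      μ.real {ω | block ℓ (fun t => V t ω) i ≠ q (block ℓ u i)} ≤ ε)
    {R : ℝ}
    (hR : W.capacity + (Real.logb 2 (Fintype.card 𝒵) + d * Real.logb 2 (Fintype.card 𝒱)
      + bigDelta (Fintype.card 𝒰) ℓ ε) / ℓ ≤ R) :
    Dtilde (𝒱 := 𝒱) ρ ℓ n u R - rhoMax ρ * ε
      ≤ 1 / (n : ℝ) * ∑ t ∈ Finset.range n, ∫ ω, ρ (u t) (V t ω) ∂μ := by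
  have hℓ : (ℓ : ℝ) ≠ 0 := NeZero.ne _
  have hrate : entropyBits (mapDist q (empDist ℓ n u)) ≤ ℓ * R := by
    refine (entropyBits_mapDist_empDist_le hY hn hdvd hV hε0 hε1 hCR).trans ?_
    calc _ = ℓ * (W.capacity + (Real.logb 2 (Fintype.card 𝒵)
          + d * Real.logb 2 (Fintype.card 𝒱) + bigDelta (Fintype.card 𝒰) ℓ ε) / ℓ) := by
          field_simp
          ring
      _ ≤ ℓ * R := by gcongr
  exact (sub_le_sub_right (Dtilde_le_empDistortion hrate) _).trans
    (empDistortion_sub_rhoMax_mul_le hρ hdvd hV.measurable hCR)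

end CommonReconstruction

theorem delta2_nonneg {J K L ℓ n : ℕ} {r η : ℕ → ℝ} (hr : 0 ≤ r n) (hη : η n < 1) :
    0 ≤ delta2 J K L ℓ n r η := by
  have hJ := logb_two_natCast_nonneg J
  have hL := logb_two_natCast_nonneg L
  have hn := logb_two_natCast_nonneg n
  have he : 0 ≤ Real.logb 2 (Real.exp 1) :=
    Real.logb_nonneg one_lt_two (Real.one_le_exp zero_le_one)
  have : 0 < 1 - η n := sub_pos.2 hη
  unfold delta2 delta1
  positivity

theorem bigDelta_nonneg {J ℓ : ℕ} {ε : ℝ} (hε0 : 0 ≤ ε) (hε1 : ε ≤ 1) : 0 ≤ bigDelta J ℓ ε :=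
  add_nonneg (h2_nonneg hε0 hε1)
    (mul_nonneg (mul_nonneg hε0 (Nat.cast_nonneg ℓ)) (logb_two_natCast_nonneg J))

theorem add_div_le_add_two_mul {C s v Δ δ : ℝ} {ℓ : ℕ} (hs : 0 ≤ s) (hΔ : 0 ≤ Δ) (hδ : 0 ≤ δ) :
    C + (s + v + Δ) / ℓ ≤ C + (2 * s + v) / ℓ + δ + 2 * Δ := by
  have hΔℓ : Δ / ℓ ≤ Δ := by
    rcases ℓ.eq_zero_or_pos with rfl | hℓ
    · simpa using hΔ
    · exact div_le_self hΔ (by exact_mod_cast hℓ)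
  have hsℓ : 0 ≤ s / ℓ := by positivity
  rw [add_div, add_div, add_div, mul_div_assoc]
  linarith


theorem theorem3 {𝒰 𝒳 𝒴 : Type*} [Fintype 𝒰] [Fintype 𝒳] [Fintype 𝒴] (ℓ : ℕ) [NeZero ℓ] :
    -- the `o(1/√n)` term of `δ₁` depends only on the alphabets of `u`, `x`, `y` and on `ℓ`
    ∃ r : ℕ → ℝ, (∀ n, 0 ≤ r n) ∧
      r =o[atTop] (fun n : ℕ => 1 / √(n : ℝ)) ∧
      ∀ {𝒱 𝒵 Ω : Type*} [Fintype 𝒱] [Fintype 𝒵] [MeasurableSpace Ω]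
        (μ : Measure Ω) [IsProbabilityMeasure μ]
        (ρ : 𝒰 → 𝒱 → ℝ) (_hρ : ∀ a v, 0 ≤ ρ a v)
        (W : DMC 𝒳 𝒴) (u : ℕ → 𝒰) (enc : (ℕ → 𝒰) → ℕ → 𝒳)
        (Y : ℕ → Ω → 𝒴) (_hY : W.IsOutput μ (enc u) Y)
        (dec : FSDecoder 𝒴 𝒱 𝒵 ℓ) (d n : ℕ) (_hn : 0 < n) (_hdvd : ℓ ∣ n)
        (V : ℕ → Ω → 𝒱) (_hV : dec.IsReconstruction d n Y V)
        (q : (Fin ℓ → 𝒰) → (Fin ℓ → 𝒱)) (ε : ℝ) (_hε0 : 0 ≤ ε) (_hε1 : ε ≤ 1)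
        (_hCR : (ℓ : ℝ) / n * ∑ i ∈ Finset.range (n / ℓ),
          μ.real {ω | block ℓ (fun t => V t ω) i ≠ q (block ℓ u i)} ≤ ε)
        (η : ℕ → ℝ) (_hη0 : ∀ m, 0 < η m) (_hη : Tendsto η atTop (nhds 0)) (_hη1 : η n < 1),
        Dtilde (𝒱 := 𝒱) ρ ℓ n u
            (W.capacity
              + (2 * Real.logb 2 (Fintype.card 𝒵) + d * Real.logb 2 (Fintype.card 𝒱)) / ℓ
              + delta2 (Fintype.card 𝒰) (Fintype.card 𝒳) (Fintype.card 𝒴) ℓ n r η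
              + 2 * bigDelta (Fintype.card 𝒰) ℓ ε)
            - rhoMax ρ * ε
          ≤ 1 / (n : ℝ) * ∑ t ∈ Finset.range n, ∫ ω, ρ (u t) (V t ω) ∂μ :=
  ⟨fun _ => 0, fun _ => le_rfl, Asymptotics.isLittleO_zero _ _,
    fun _ _ _ hρ _ _ _ _ hY _ _ _ hn hdvd _ hV _ _ hε0 hε1 hCR _ _ _ hη1 =>
      theorem3_general hρ hY hn hdvd hV hε0 hε1 hCR <| add_div_le_add_two_mul
        (logb_two_natCast_nonneg _) (bigDelta_nonneg hε0 hε1) (delta2_nonneg le_rfl hη1)⟩
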